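/- **Simons' inequality.** Let $E\subseteq\mathbb{R}^n$ be a cone, i.e. $tp\in E$ for all $p\in E$ and $t>0$. Call $x\in\partial E$ a regular point if, near $x$, $\partial E$ is a hypersurface of class $C^k$ with $E$ on one side of it, where $k\ge 4$ is fixed ($k=\infty$, the smooth case, is allowed); that is, near $x$ there is a $C^k$ function $\varphi$ with nonvanishing gradient such that $\partial E=\{\varphi=0\}$, $\{\varphi<0\}\subseteq E$ and $\{\varphi>0\}\subseteq \mathbb{R}^n\setminus E$. At regular points let $\nu=\nabla\varphi/|\nabla\varphi|$ be the exterior unit normal, and for functions $f$ and vector fields $F$ on $\partial E$ let $$\partial_{T,j}f=\partial_j f-(\nabla f\cdot\nu)\nu_j,\qquad \nabla_T f=(\partial_{T,1}f,\dots,\partial_{T,n}f),\qquad \operatorname{div}_T F=\sum_{i=1}^n\partial_{T,i}F_i,\qquad \Delta_T f=\operatorname{div}_T(\nabla_T f)$$ be the tangential derivatives, tangential gradient, tangential divergence and Laplace--Beltrami operator (computed with any extension of $f$, $F$ to a neighbourhood), let $H=\operatorname{div}_T\nu$ be the mean curvature, and let $$c=\Big(\sum_{i,j=1}^n(\partial_{T,j}\nu_i)^2\Big)^{1/2}$$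 be the norm of the second fundamental form. Suppose that $H=0$ at every regular point. Let $x\ne0$ be a regular point. Then near $x$ the function $c^2$ on $\partial E$ is the restriction of a $C^2$ function; if $c(x)\neq0$, then $c$ is differentiable along $\partial E$ at $x$; whenever $c$ is differentiable along $\partial E$ at $x$, $$\frac{\Delta_T c^2(x)}{2}\;\ge\;|\nabla_T c(x)|^2+\frac{2c^2(x)}{|x|^2}-c^4(x);$$ and if $c(x)=0$ (where $c$ may fail to be differentiable), then $\Delta_T c^2(x)\ge0$. -/

import Mathlib

open Set Filter Topology
open scoped ContDiff RealInnerProductSpace Gradient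

noncomputable section

namespace ConeGeometry

/-- A cone: `p ∈ E` implies `t p ∈ E` for every `t > 0`. -/
def IsCone {n : ℕ} (E : Set (EuclideanSpace ℝ (Fin n))) : Prop :=
  ∀ p ∈ E, ∀ t : ℝ, 0 < t → t • p ∈ E

/-- `φ` is a defining function of class `C^k` for `E` in the open set `U`: its gradient does not
vanish, `∂E` is its zero set, `E` lies where `φ` is negative and the complement of `E` where `φ`
is positive. -/
structure IsDefiningFunction {n : ℕ} (k : WithTop ℕ∞) (E U : Set (EuclideanSpace ℝ (Fin n)))
    (φ : EuclideanSpace ℝ (Fin n) → ℝ) : Prop where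
  isOpen : IsOpen U
  contDiffOn : ContDiffOn ℝ k φ U
  gradient_ne_zero : ∀ y ∈ U, ∇ φ y ≠ 0
  mem_frontier_iff : ∀ y ∈ U, (y ∈ frontier E ↔ φ y = 0)
  mem_of_neg : ∀ y ∈ U, φ y < 0 → y ∈ E
  notMem_of_pos : ∀ y ∈ U, 0 < φ y → y ∉ E

/-- The `C^k`-regular points of `∂E`: those near which `∂E` is a hypersurface of class `C^k`
with `E` on one side. -/
def IsRegularPoint {n : ℕ} (k : WithTop ℕ∞) (E : Set (EuclideanSpace ℝ (Fin n)))
    (x : EuclideanSpace ℝ (Fin n)) : Prop :=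
  x ∈ frontier E ∧ ∃ U φ, x ∈ U ∧ IsDefiningFunction k E U φ

/-- `v` is the exterior unit normal to `E` at `x ∈ ∂E`: the normalized gradient of a defining
function. -/
def IsExteriorNormal {n : ℕ} (E : Set (EuclideanSpace ℝ (Fin n)))
    (x v : EuclideanSpace ℝ (Fin n)) : Prop :=
  x ∈ frontier E ∧ ∃ U φ, x ∈ U ∧ IsDefiningFunction 1 E U φ ∧ v = ‖∇ φ x‖⁻¹ • ∇ φ x

open Classical in
/-- The exterior unit normal `ν` (with value `0` where there is none). -/
def exteriorNormal {n : ℕ} (E : Set (EuclideanSpace ℝ (Fin n)))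
    (x : EuclideanSpace ℝ (Fin n)) : EuclideanSpace ℝ (Fin n) :=
  if h : ∃ v, IsExteriorNormal E x v then h.choose else 0

/-- The tangential derivative of `F` at `x ∈ ∂E` along the tangential part `v - (ν · v) ν` of `v`.
Only the values of `F` on `∂E` matter. -/
def tangentialDeriv {n : ℕ} {G : Type*} [NormedAddCommGroup G] [NormedSpace ℝ G]
    (E : Set (EuclideanSpace ℝ (Fin n))) (F : EuclideanSpace ℝ (Fin n) → G)
    (x v : EuclideanSpace ℝ (Fin n)) : G :=
  fderivWithin ℝ F (frontier E) x (v - ⟪exteriorNormal E x, v⟫ • exteriorNormal E x)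

/-- The tangential gradient `∇_T f`, whose `j`-th component is the tangential derivative along
the `j`-th coordinate vector; it is `∇ f - (∇ f · ν) ν` for every differentiable extension. -/
def tangentialGradient {n : ℕ} (E : Set (EuclideanSpace ℝ (Fin n)))
    (f : EuclideanSpace ℝ (Fin n) → ℝ) (x : EuclideanSpace ℝ (Fin n)) :
    EuclideanSpace ℝ (Fin n) :=
  WithLp.toLp 2 fun j => tangentialDeriv E f x (EuclideanSpace.single j 1)

/-- The tangential divergence of a vector field along `∂E`, the trace of its tangential
derivative; it is `div F - (DF ν) · ν` for every differentiable extension. -/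
def tangentialDiv {n : ℕ} (E : Set (EuclideanSpace ℝ (Fin n)))
    (F : EuclideanSpace ℝ (Fin n) → EuclideanSpace ℝ (Fin n)) (x : EuclideanSpace ℝ (Fin n)) : ℝ :=
  ∑ i, tangentialDeriv E F x (EuclideanSpace.single i 1) i

/-- The Laplace-Beltrami operator `Δ_T f = div_T ∇_T f` of `∂E`. -/
def laplaceBeltrami {n : ℕ} (E : Set (EuclideanSpace ℝ (Fin n)))
    (f : EuclideanSpace ℝ (Fin n) → ℝ) (x : EuclideanSpace ℝ (Fin n)) : ℝ :=
  tangentialDiv E (tangentialGradient E f) x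

/-- The mean curvature `H = div_T ν` (the sum of the principal curvatures). -/
def meanCurvature {n : ℕ} (E : Set (EuclideanSpace ℝ (Fin n)))
    (x : EuclideanSpace ℝ (Fin n)) : ℝ :=
  tangentialDiv E (exteriorNormal E) x

/-- The norm `c` of the second fundamental form `∇_T ν`. -/
def secondFormNorm {n : ℕ} (E : Set (EuclideanSpace ℝ (Fin n)))
    (x : EuclideanSpace ℝ (Fin n)) : ℝ :=
  √(∑ i, ∑ j, (tangentialDeriv E (exteriorNormal E) x (EuclideanSpace.single j 1) i) ^ 2)

end ConeGeometry

end

namespace ConeGeometry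

theorem eventually_neg_of_inner_gradient_neg {n : ℕ} {φ : EuclideanSpace ℝ (Fin n) → ℝ}
    {x w : EuclideanSpace ℝ (Fin n)} (hd : DifferentiableAt ℝ φ x) (h0 : φ x = 0)
    (hw : ⟪∇ φ x, w⟫ < 0) : ∀ᶠ t : ℝ in 𝓝[>] 0, φ (x + t • w) < 0 := by
  have h1 : HasFDerivAt φ (fderiv ℝ φ x) (x + (0 : ℝ) • w) := by simpa using hd.hasFDerivAt
  have h2 : HasDerivAt (fun t : ℝ => x + t • w) w 0 := by
    simpa using ((hasDerivAt_id (0 : ℝ)).smul_const w).const_add x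
  have h3 : HasDerivAt (fun t : ℝ => φ (x + t • w)) ⟪∇ φ x, w⟫ 0 := by
    have := h1.comp_hasDerivAt (0 : ℝ) h2
    rwa [show fderiv ℝ φ x w = ⟪∇ φ x, w⟫ by simp [gradient]] at this
  have h4 := (hasDerivAt_iff_tendsto_slope_zero.1 h3).mono_left
    (nhdsWithin_mono 0 (fun t (ht : (0 : ℝ) < t) => ht.ne'))
  filter_upwards [h4.eventually (gt_mem_nhds hw), self_mem_nhdsWithin] with t ht ht0
  simp only [zero_add, zero_smul, add_zero, h0, sub_zero, smul_eq_mul] at ht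
  have ht0' : 0 < t := ht0
  by_contra hc
  have : 0 ≤ t⁻¹ * φ (x + t • w) := mul_nonneg (inv_nonneg.2 ht0'.le) (not_lt.1 hc)
  linarith

/-- The exterior unit normal does not depend on the defining function. -/
theorem IsExteriorNormal.unique {n : ℕ} {E : Set (EuclideanSpace ℝ (Fin n))}
    {x a b : EuclideanSpace ℝ (Fin n)} (ha : IsExteriorNormal E x a)
    (hb : IsExteriorNormal E x b) : a = b := by
  obtain ⟨hx, U, φ, hU, hφ, rfl⟩ := ha
  obtain ⟨-, V, ψ, hV, hψ, rfl⟩ := hb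
  have dφ : DifferentiableAt ℝ φ x :=
    (hφ.contDiffOn.differentiableOn one_ne_zero).differentiableAt (hφ.isOpen.mem_nhds hU)
  have dψ : DifferentiableAt ℝ ψ x :=
    (hψ.contDiffOn.differentiableOn one_ne_zero).differentiableAt (hψ.isOpen.mem_nhds hV)
  have nφ : 0 < ‖∇ φ x‖ := norm_pos_iff.2 (hφ.gradient_ne_zero x hU)
  have nψ : 0 < ‖∇ ψ x‖ := norm_pos_iff.2 (hψ.gradient_ne_zero x hV)
  set a := ‖∇ φ x‖⁻¹ • ∇ φ x with hadef
  set b := ‖∇ ψ x‖⁻¹ • ∇ ψ x with hbdef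
  have haa : ‖a‖ = 1 := by rw [hadef, norm_smul, norm_inv, norm_norm, inv_mul_cancel₀ nφ.ne']
  have hbb : ‖b‖ = 1 := by rw [hbdef, norm_smul, norm_inv, norm_norm, inv_mul_cancel₀ nψ.ne']
  by_contra hab
  have hlt : ⟪a, b⟫ < 1 := (inner_lt_one_iff_real_of_norm_eq_one haa hbb).2 hab
  have e1 : ⟪∇ φ x, b - a⟫ < 0 := by
    have : ∇ φ x = ‖∇ φ x‖ • a := by rw [hadef, smul_inv_smul₀ nφ.ne']
    rw [this, real_inner_smul_left, inner_sub_right, real_inner_self_eq_norm_sq, haa]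
    nlinarith
  have e2 : ⟪∇ (-ψ) x, b - a⟫ < 0 := by
    have h1 : ∇ (-ψ) x = - ∇ ψ x := by simp [gradient, fderiv_neg]
    have : ∇ ψ x = ‖∇ ψ x‖ • b := by rw [hbdef, smul_inv_smul₀ nψ.ne']
    rw [h1, inner_neg_left, this, real_inner_smul_left, inner_sub_right,
      real_inner_self_eq_norm_sq, hbb, real_inner_comm]
    nlinarith
  have f1 := eventually_neg_of_inner_gradient_neg dφ ((hφ.mem_frontier_iff x hU).1 hx) e1
  have f2 := eventually_neg_of_inner_gradient_neg dψ.neg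
    (by simpa using (hψ.mem_frontier_iff x hV).1 hx) e2
  have hc : Tendsto (fun t : ℝ => x + t • (b - a)) (𝓝[>] 0) (𝓝 x) := by
    have : Continuous (fun t : ℝ => x + t • (b - a)) := by fun_prop
    simpa using (this.tendsto 0).mono_left nhdsWithin_le_nhds
  obtain ⟨t, h1, h2, h3, h4⟩ := (f1.and (f2.and ((hc.eventually
    (hφ.isOpen.mem_nhds hU)).and (hc.eventually (hψ.isOpen.mem_nhds hV))))).exists
  exact hψ.notMem_of_pos _ h4 (by simpa using h2) (hφ.mem_of_neg _ h3 h1)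

theorem exteriorNormal_eq {n : ℕ} {E : Set (EuclideanSpace ℝ (Fin n))}
    {x v : EuclideanSpace ℝ (Fin n)} (h : IsExteriorNormal E x v) : exteriorNormal E x = v := by
  have h' : ∃ v, IsExteriorNormal E x v := ⟨v, h⟩
  rw [exteriorNormal, dif_pos h']
  exact h'.choose_spec.unique h

end ConeGeometry

open ConeGeometry

/-! Extend the normal off the boundary by N = ∇φ/|∇φ|, write δ_i for the derivative along the
tangential part of the i-th coordinate vector, and put A_ij = δ_i N_j. Symmetry of the Hessian makes
A symmetric, and |N| = 1 gives A N = 0. All operators on the boundary become sums of δ's, so the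
proof is a computation in ambient coordinates.

Commuting δ's yields the Codazzi equation. Applied twice and traced, it gives the Laplacian of A up
to terms carrying a factor N_i or N_j, which disappear on contraction with A. With vanishing mean
curvature the result is ½ Δ|A|² = |δA|² − |A|⁴ − 2|A²|² (`sum_tderiv_tderiv_sffNormSq`). The term
2|A²|² arises because |δA|² is taken in ambient coordinates and includes normal components.

What remains is a Kato inequality with gain: c²|∇c|² = Σ_l (A : δ_l A)² is to be bounded by c²(|δA|²
− 2c²/|x|² − 2|A²|²) (`sum_sq_sum_sff_mul_tderiv_le`). On a cone, A annihilates both N and the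
position vector x. Differentiating these relations shows how δ_l A acts on N and on x: it gives
minus the l-th rows of A² and of A. Those parts of δ_l A are invisible to A : δ_l A, so they can be
removed before applying Cauchy-Schwarz (`sq_sum_mul_le_of_annihilates`). Dividing by c² and
inserting Simons' identity finishes the case c ≠ 0. If c = 0, then A = 0, the identity reduces to ½
Δc² = |δA|², and c has a minimum, so its tangential gradient vanishes. -/

namespace ConeGeometry

/-! ### Tangent vectors of the boundary -/

/-- A direction in the kernel of the derivative of a strictly differentiable submersion is tangent
to the level set. -/
theorem mem_posTangentConeAt_level {V : Type*} [NormedAddCommGroup V] [NormedSpace ℝ V]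
    [CompleteSpace V] {φ : V → ℝ} {φ' : V →L[ℝ] ℝ} {x w : V} {s : Set V}
    (hφ : HasStrictFDerivAt φ φ' x) (hne : φ' ≠ 0) (hw : φ' w = 0)
    (hs : ∀ᶠ y in 𝓝 x, φ y = φ x → y ∈ s) : w ∈ posTangentConeAt s x := by
  have hsurj : (φ' : V →ₗ[ℝ] ℝ).range = ⊤ := by
    rw [LinearMap.range_eq_top]
    exact LinearMap.surjective (fun h => hne (ContinuousLinearMap.coe_injective (by simpa using h)))
  -- The implicit function maps the line through 0 with direction w in the kernel to a curve in the
  -- level set, starting at x with velocity w.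
  set γ : ℝ → V := fun t => hφ.implicitFunction φ φ' hsurj (φ x)
    (t • (⟨w, hw⟩ : (φ' : V →ₗ[ℝ] ℝ).ker)) with hγ
  have h0 : γ 0 = x := by simp [hγ]
  have hline : HasDerivAt (fun t : ℝ => t • (⟨w, hw⟩ : (φ' : V →ₗ[ℝ] ℝ).ker)) ⟨w, hw⟩ 0 := by
    simpa using (hasDerivAt_id (0 : ℝ)).smul_const (⟨w, hw⟩ : (φ' : V →ₗ[ℝ] ℝ).ker)
  have hderiv : HasDerivAt γ w 0 := by
    have h1 := (hφ.to_implicitFunction hsurj).hasFDerivAt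
    rw [← zero_smul ℝ (⟨w, hw⟩ : (φ' : V →ₗ[ℝ] ℝ).ker)] at h1
    exact h1.comp_hasDerivAt (0 : ℝ) hline
  have hγt : Tendsto γ (𝓝 0) (𝓝 x) := by simpa [h0] using hderiv.continuousAt.tendsto
  have hpair : Tendsto (fun t : ℝ => (φ x, t • (⟨w, hw⟩ : (φ' : V →ₗ[ℝ] ℝ).ker))) (𝓝 0)
      (𝓝 (φ x, 0)) := by
    refine tendsto_const_nhds.prodMk_nhds ?_
    simpa using hline.continuousAt.tendsto
  have hlev : ∀ᶠ t in 𝓝 (0 : ℝ), φ (γ t) = φ x :=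
    hpair.eventually (hφ.map_implicitFunction_eq hsurj)
  have hle : 𝓝[>] (0 : ℝ) ≤ 𝓝 0 := nhdsWithin_le_nhds
  -- The positive tangent cone has scalars in the nonnegative reals, hence `toNNReal` and the
  -- one-sided filter.
  refine mem_tangentConeAt_of_seq (𝓝[>] (0 : ℝ)) (fun t => (t⁻¹).toNNReal) (fun t => γ t - x)
    ?_ ?_ ?_
  · simpa using (hγt.sub_const x).mono_left hle
  · filter_upwards [hle hlev, hle (hγt.eventually hs)] with t h1 h2
    simpa using h2 h1
  · have h4 := (hasDerivAt_iff_tendsto_slope_zero.1 hderiv).mono_left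
      (nhdsWithin_mono 0 (fun t (ht : (0 : ℝ) < t) => ht.ne'))
    refine h4.congr' ?_
    filter_upwards [self_mem_nhdsWithin] with t ht
    have ht0 : (0 : ℝ) < t := ht
    simp [NNReal.smul_def, h0, ht0.le]

/-! ### Defining functions, the unit normal and tangential derivatives. -/

variable {n : ℕ} {E U : Set (EuclideanSpace ℝ (Fin n))} {φ : EuclideanSpace ℝ (Fin n) → ℝ}
  {k m : WithTop ℕ∞}

theorem IsDefiningFunction.of_le (h : IsDefiningFunction k E U φ) (hm : m ≤ k) :
    IsDefiningFunction m E U φ :=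
  ⟨h.isOpen, h.contDiffOn.of_le hm, h.gradient_ne_zero, h.mem_frontier_iff, h.mem_of_neg,
    h.notMem_of_pos⟩

theorem IsDefiningFunction.contDiffAt (h : IsDefiningFunction k E U φ)
    {y : EuclideanSpace ℝ (Fin n)} (hy : y ∈ U) : ContDiffAt ℝ k φ y :=
  h.contDiffOn.contDiffAt (h.isOpen.mem_nhds hy)

/-- The normalized gradient. -/
noncomputable def unitGradient (φ : EuclideanSpace ℝ (Fin n) → ℝ) (y : EuclideanSpace ℝ (Fin n)) :
    EuclideanSpace ℝ (Fin n) :=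
  ‖∇ φ y‖⁻¹ • ∇ φ y

theorem inner_gradient_left (φ : EuclideanSpace ℝ (Fin n) → ℝ) (y w : EuclideanSpace ℝ (Fin n)) :
    ⟪∇ φ y, w⟫ = fderiv ℝ φ y w := by
  simp [gradient]

theorem IsDefiningFunction.norm_unitGradient (h : IsDefiningFunction k E U φ)
    {y : EuclideanSpace ℝ (Fin n)} (hy : y ∈ U) : ‖unitGradient φ y‖ = 1 := by
  rw [unitGradient, norm_smul, norm_inv, norm_norm,
    inv_mul_cancel₀ (norm_ne_zero_iff.2 (h.gradient_ne_zero y hy))]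

theorem IsDefiningFunction.exteriorNormal_eq (h : IsDefiningFunction k E U φ) (hk : 1 ≤ k)
    {y : EuclideanSpace ℝ (Fin n)} (hy : y ∈ U) (hyE : y ∈ frontier E) :
    exteriorNormal E y = unitGradient φ y :=
  ConeGeometry.exteriorNormal_eq ⟨hyE, U, φ, hy, h.of_le hk, rfl⟩

theorem IsDefiningFunction.contDiffOn_gradient (h : IsDefiningFunction k E U φ)
    (hm : m + 1 ≤ k) : ContDiffOn ℝ m (∇ φ) U :=
  (LinearIsometryEquiv.contDiff _).comp_contDiffOn (h.contDiffOn.fderiv_of_isOpen h.isOpen hm)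

theorem IsDefiningFunction.contDiffOn_unitGradient (h : IsDefiningFunction k E U φ)
    (hm : m + 1 ≤ k) : ContDiffOn ℝ m (unitGradient φ) U := by
  have h1 := h.contDiffOn_gradient hm
  exact ((h1.norm ℝ h.gradient_ne_zero).inv
    fun y hy => norm_ne_zero_iff.2 (h.gradient_ne_zero y hy)).smul h1

theorem IsDefiningFunction.mem_posTangentConeAt (h : IsDefiningFunction k E U φ) (hk : 1 ≤ k)
    {y w : EuclideanSpace ℝ (Fin n)} (hy : y ∈ U) (hyE : y ∈ frontier E)
    (hw : ⟪unitGradient φ y, w⟫ = 0) : w ∈ posTangentConeAt (frontier E) y := by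
  have h0 := (h.mem_frontier_iff y hy).1 hyE
  refine mem_posTangentConeAt_level
    ((h.contDiffAt hy).hasStrictFDerivAt (by positivity)) (fun h0 => ?_) ?_ ?_
  · exact h.gradient_ne_zero y hy (by simp [gradient, h0])
  · rw [unitGradient, real_inner_smul_left, inner_gradient_left] at hw
    exact (mul_eq_zero.1 hw).resolve_left
      (inv_ne_zero (norm_ne_zero_iff.2 (h.gradient_ne_zero y hy)))
  · filter_upwards [h.isOpen.mem_nhds hy] with z hz hz0
    exact (h.mem_frontier_iff z hz).2 (hz0.trans h0)

theorem posTangentConeAt_subset_tangentConeAt {V : Type*} [NormedAddCommGroup V] [NormedSpace ℝ V]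
    {s : Set V} {x : V} : posTangentConeAt s x ⊆ tangentConeAt ℝ s x :=
  tangentConeAt_mono_field

theorem IsDefiningFunction.inner_tangential (h : IsDefiningFunction k E U φ)
    {y : EuclideanSpace ℝ (Fin n)} (hy : y ∈ U) (v : EuclideanSpace ℝ (Fin n)) :
    ⟪unitGradient φ y, v - ⟪unitGradient φ y, v⟫ • unitGradient φ y⟫ = 0 := by
  rw [inner_sub_right, real_inner_smul_right, real_inner_self_eq_norm_sq, h.norm_unitGradient hy]
  ring

/-- A derivative within a hypersurface is not unique, but any two agree on the tangent cone, and the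
projected vector lies there. So `fderivWithin` may be replaced by whichever derivative is at hand.
-/
theorem IsDefiningFunction.tangentialDeriv_eq {G : Type*} [NormedAddCommGroup G] [NormedSpace ℝ G]
    (h : IsDefiningFunction k E U φ) (hk : 1 ≤ k)
    {y : EuclideanSpace ℝ (Fin n)} (hy : y ∈ U) (hyE : y ∈ frontier E)
    {F : EuclideanSpace ℝ (Fin n) → G} {F' : EuclideanSpace ℝ (Fin n) →L[ℝ] G}
    (hF : HasFDerivWithinAt F F' (frontier E) y) (v : EuclideanSpace ℝ (Fin n)) :
    tangentialDeriv E F y v = F' (v - ⟪unitGradient φ y, v⟫ • unitGradient φ y) := by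
  rw [tangentialDeriv, h.exteriorNormal_eq hk hy hyE]
  exact hF.differentiableWithinAt.hasFDerivWithinAt.unique_on hF
    (posTangentConeAt_subset_tangentConeAt (h.mem_posTangentConeAt hk hy hyE
      (h.inner_tangential hy v)))

theorem IsDefiningFunction.tangentialDeriv_eq_fderiv {G : Type*} [NormedAddCommGroup G]
    [NormedSpace ℝ G] (h : IsDefiningFunction k E U φ) (hk : 1 ≤ k)
    {y : EuclideanSpace ℝ (Fin n)} (hy : y ∈ U) (hyE : y ∈ frontier E)
    {F F₁ : EuclideanSpace ℝ (Fin n) → G} (hF : ∀ z ∈ U, z ∈ frontier E → F z = F₁ z)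
    (hF₁ : DifferentiableAt ℝ F₁ y) (v : EuclideanSpace ℝ (Fin n)) :
    tangentialDeriv E F y v = fderiv ℝ F₁ y (v - ⟪unitGradient φ y, v⟫ • unitGradient φ y) := by
  refine h.tangentialDeriv_eq hk hy hyE ?_ v
  refine hF₁.hasFDerivAt.hasFDerivWithinAt.congr_of_eventuallyEq ?_ (hF y hy hyE)
  filter_upwards [mem_nhdsWithin_of_mem_nhds (h.isOpen.mem_nhds hy), self_mem_nhdsWithin]
    with z hz hzE using hF z hz hzE

/-- The second fundamental form of the level sets is symmetric. -/
theorem IsDefiningFunction.inner_fderiv_unitGradient_comm (h : IsDefiningFunction k E U φ)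
    (hk : 2 ≤ k) {y v w : EuclideanSpace ℝ (Fin n)} (hy : y ∈ U)
    (hv : ⟪unitGradient φ y, v⟫ = 0) (hw : ⟪unitGradient φ y, w⟫ = 0) :
    ⟪fderiv ℝ (unitGradient φ) y v, w⟫ = ⟪fderiv ℝ (unitGradient φ) y w, v⟫ := by
  have hg : DifferentiableAt ℝ (∇ φ) y :=
    ((h.contDiffOn_gradient (m := 1) (by simpa [one_add_one_eq_two] using hk)).differentiableOn
      one_ne_zero).differentiableAt (h.isOpen.mem_nhds hy)
  have hφ' : DifferentiableAt ℝ (fderiv ℝ φ) y :=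
    ((h.contDiffOn.fderiv_of_isOpen (m := 1) h.isOpen
      (by simpa [one_add_one_eq_two] using hk)).differentiableOn
      one_ne_zero).differentiableAt (h.isOpen.mem_nhds hy)
  have hr : DifferentiableAt ℝ (fun z => ‖∇ φ z‖⁻¹) y :=
    (hg.norm ℝ (h.gradient_ne_zero y hy)).inv (norm_ne_zero_iff.2 (h.gradient_ne_zero y hy))
  have hsymm := ((h.contDiffAt hy).of_le hk).isSymmSndFDerivAt (by simp)
  -- Differentiating the factor ‖∇φ‖⁻¹ produces a multiple of ∇φ, which is orthogonal to w; only the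
  -- Hessian survives.
  have key : ∀ v w : EuclideanSpace ℝ (Fin n), ⟪unitGradient φ y, w⟫ = 0 →
      ⟪fderiv ℝ (unitGradient φ) y v, w⟫ = ‖∇ φ y‖⁻¹ * fderiv ℝ (fderiv ℝ φ) y v w := by
    intro v w hw
    have hw' : fderiv ℝ φ y w = 0 := by
      rw [unitGradient, real_inner_smul_left, inner_gradient_left] at hw
      exact (mul_eq_zero.1 hw).resolve_left
        (inv_ne_zero (norm_ne_zero_iff.2 (h.gradient_ne_zero y hy)))
    have h1 : HasFDerivAt (unitGradient φ) _ y := hr.hasFDerivAt.smul hg.hasFDerivAt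
    have h2 : ⟪fderiv ℝ (∇ φ) y v, w⟫ = fderiv ℝ (fderiv ℝ φ) y v w := by
      have h3 : HasFDerivAt (fun z => ⟪∇ φ z, w⟫) _ y := hg.hasFDerivAt.inner ℝ
        (hasFDerivAt_const w y)
      have h4 : HasFDerivAt (fun z => fderiv ℝ φ z w) _ y := hφ'.hasFDerivAt.clm_apply
        (hasFDerivAt_const w y)
      simp only [inner_gradient_left] at h3
      simpa using congrArg (fun L => L v) (h3.unique h4)
    rw [h1.fderiv]
    simp [inner_add_left, real_inner_smul_left, hw', h2]
  rw [key v w hw, key w v hv, hsymm.eq]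

/-- The boundary of a cone is a cone. -/
theorem IsCone.frontier (hE : IsCone E) : IsCone (frontier E) := by
  intro p hp t ht
  have h1 : (Homeomorph.smulOfNeZero t ht.ne') ⁻¹' E = E := by
    ext q
    refine ⟨fun hq => ?_, fun hq => hE q hq t ht⟩
    simpa [smul_smul, inv_mul_cancel₀ ht.ne'] using hE _ hq t⁻¹ (inv_pos.2 ht)
  have h2 := (Homeomorph.smulOfNeZero (α := EuclideanSpace ℝ (Fin n)) t ht.ne').preimage_frontier E
  rw [h1] at h2
  rw [← h2] at hp
  exact hp

/-- The ray through y stays in the boundary, so φ(t y) = 0 for t near 1; differentiate at t = 1. -/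
theorem IsDefiningFunction.inner_self_eq_zero (h : IsDefiningFunction k E U φ) (hk : 1 ≤ k)
    (hE : IsCone E) {y : EuclideanSpace ℝ (Fin n)} (hy : y ∈ U) (hyE : y ∈ frontier E) :
    ⟪unitGradient φ y, y⟫ = 0 := by
  have hd : HasFDerivAt φ (fderiv ℝ φ y) ((1 : ℝ) • y) := by
    rw [one_smul]
    exact ((h.contDiffAt hy).differentiableAt (by positivity)).hasFDerivAt
  have hl : HasDerivAt (fun t : ℝ => t • y) y 1 := by
    simpa using (hasDerivAt_id (1 : ℝ)).smul_const y
  have h1 : HasDerivAt (fun t : ℝ => φ (t • y)) (fderiv ℝ φ y y) 1 := hd.comp_hasDerivAt 1 hl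
  have hU : ∀ᶠ t in 𝓝 (1 : ℝ), t • y ∈ U :=
    hl.continuousAt.eventually (h.isOpen.mem_nhds (by simpa using hy))
  have h2 : (fun t : ℝ => φ (t • y)) =ᶠ[𝓝 1] fun _ => 0 := by
    filter_upwards [hU, lt_mem_nhds (zero_lt_one (α := ℝ))] with t ht ht0
    exact (h.mem_frontier_iff _ ht).1 (hE.frontier y hyE t ht0)
  have h3 := (h1.congr_of_eventuallyEq h2.symm).unique (hasDerivAt_const (1 : ℝ) (0 : ℝ))
  rw [unitGradient, real_inner_smul_left, inner_gradient_left, h3, mul_zero]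

end ConeGeometry

namespace ConeGeometry

/-! ### Tangential calculus along the level sets of a unit normal field -/

variable {n : ℕ} {U : Set (EuclideanSpace ℝ (Fin n))}
  {N : EuclideanSpace ℝ (Fin n) → EuclideanSpace ℝ (Fin n)}
  {y : EuclideanSpace ℝ (Fin n)}

/-- A unit field of class `C^3` whose derivative is symmetric on the orthogonal hyperplanes. -/
structure IsNormalField (N : EuclideanSpace ℝ (Fin n) → EuclideanSpace ℝ (Fin n))
    (U : Set (EuclideanSpace ℝ (Fin n))) : Prop where
  isOpen : IsOpen U
  contDiffOn : ContDiffOn ℝ 3 N U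
  norm_eq_one : ∀ y ∈ U, ‖N y‖ = 1
  inner_fderiv_comm : ∀ y ∈ U, ∀ v w, ⟪N y, v⟫ = 0 → ⟪N y, w⟫ = 0 →
    ⟪fderiv ℝ N y v, w⟫ = ⟪fderiv ℝ N y w, v⟫

/-- Normalizing the gradient costs one derivative and forming A another, so four derivatives of φ
leave the two that the Laplacian of A needs. -/
theorem IsDefiningFunction.isNormalField {k : WithTop ℕ∞} {E : Set (EuclideanSpace ℝ (Fin n))}
    {φ : EuclideanSpace ℝ (Fin n) → ℝ} (h : IsDefiningFunction k E U φ) (hk : 4 ≤ k) :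
    IsNormalField (unitGradient φ) U where
  isOpen := h.isOpen
  contDiffOn := h.contDiffOn_unitGradient (le_trans (by norm_num) hk)
  norm_eq_one _ hy := h.norm_unitGradient hy
  inner_fderiv_comm _ hy _ _ hv hw :=
    h.inner_fderiv_unitGradient_comm (le_trans (by norm_num) hk) hy hv hw

/-- The projection of the `i`-th coordinate vector to the hyperplane orthogonal to `N`. -/
noncomputable def tproj (N : EuclideanSpace ℝ (Fin n) → EuclideanSpace ℝ (Fin n)) (i : Fin n)
    (y : EuclideanSpace ℝ (Fin n)) : EuclideanSpace ℝ (Fin n) :=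
  EuclideanSpace.single i 1 - N y i • N y

/-- The derivative along the tangential part of the `i`-th coordinate vector. -/
noncomputable def tderiv (N : EuclideanSpace ℝ (Fin n) → EuclideanSpace ℝ (Fin n)) (i : Fin n)
    (f : EuclideanSpace ℝ (Fin n) → ℝ) (y : EuclideanSpace ℝ (Fin n)) : ℝ :=
  fderiv ℝ f y (tproj N i y)

/-- The second fundamental form `δ_i N_j`. -/
noncomputable def sff (N : EuclideanSpace ℝ (Fin n) → EuclideanSpace ℝ (Fin n)) (i j : Fin n) :
    EuclideanSpace ℝ (Fin n) → ℝ :=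
  tderiv N i fun z => N z j

/-- The square of the second fundamental form. -/
noncomputable def sffSq (N : EuclideanSpace ℝ (Fin n) → EuclideanSpace ℝ (Fin n)) (i j : Fin n)
    (y : EuclideanSpace ℝ (Fin n)) : ℝ :=
  ∑ b, sff N i b y * sff N b j y

theorem tderiv_congr {f g : EuclideanSpace ℝ (Fin n) → ℝ} (i : Fin n) (hfg : f =ᶠ[𝓝 y] g) :
    tderiv N i f y = tderiv N i g y := by
  rw [tderiv, tderiv, hfg.fderiv_eq]

theorem tderiv_const (i : Fin n) (c : ℝ) : tderiv N i (fun _ => c) y = 0 := by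
  simp [tderiv]

theorem tderiv_add {f g : EuclideanSpace ℝ (Fin n) → ℝ} (i : Fin n) (hf : DifferentiableAt ℝ f y)
    (hg : DifferentiableAt ℝ g y) :
    tderiv N i (fun z => f z + g z) y = tderiv N i f y + tderiv N i g y := by
  rw [tderiv, fderiv_fun_add hf hg]
  rfl

theorem tderiv_sub {f g : EuclideanSpace ℝ (Fin n) → ℝ} (i : Fin n) (hf : DifferentiableAt ℝ f y)
    (hg : DifferentiableAt ℝ g y) :
    tderiv N i (fun z => f z - g z) y = tderiv N i f y - tderiv N i g y := by
  rw [tderiv, fderiv_fun_sub hf hg]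
  rfl

theorem tderiv_mul {f g : EuclideanSpace ℝ (Fin n) → ℝ} (i : Fin n) (hf : DifferentiableAt ℝ f y)
    (hg : DifferentiableAt ℝ g y) :
    tderiv N i (fun z => f z * g z) y = tderiv N i f y * g y + f y * tderiv N i g y := by
  rw [tderiv, fderiv_fun_mul hf hg]
  simp only [add_apply, smul_apply, smul_eq_mul, tderiv]
  ring

theorem tderiv_sum {ι : Type*} (s : Finset ι) {f : ι → EuclideanSpace ℝ (Fin n) → ℝ} (i : Fin n)
    (hf : ∀ a ∈ s, DifferentiableAt ℝ (f a) y) :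
    tderiv N i (fun z => ∑ a ∈ s, f a z) y = ∑ a ∈ s, tderiv N i (f a) y := by
  rw [tderiv, fderiv_fun_sum hf]
  simp [tderiv]

theorem tderiv_sum_mul {ι : Type*} (s : Finset ι) {f g : ι → EuclideanSpace ℝ (Fin n) → ℝ}
    (i : Fin n) (hf : ∀ a, DifferentiableAt ℝ (f a) y) (hg : ∀ a, DifferentiableAt ℝ (g a) y) :
    tderiv N i (fun z => ∑ a ∈ s, f a z * g a z) y
      = ∑ a ∈ s, (tderiv N i (f a) y * g a y + f a y * tderiv N i (g a) y) := by
  rw [tderiv_sum s i fun a _ => (hf a).fun_mul (hg a)]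
  exact Finset.sum_congr rfl fun a _ => tderiv_mul i (hf a) (hg a)

/-! ### Symmetry of A, commutators and the Codazzi equation. -/

namespace IsNormalField

theorem contDiffOn_apply (h : IsNormalField N U) (j : Fin n) :
    ContDiffOn ℝ 3 (fun z => N z j) U :=
  contDiffOn_euclidean.1 h.contDiffOn j

theorem differentiableAt (h : IsNormalField N U) (hy : y ∈ U) : DifferentiableAt ℝ N y :=
  (h.contDiffOn.differentiableOn (by norm_num)).differentiableAt (h.isOpen.mem_nhds hy)

theorem differentiableAt_apply (h : IsNormalField N U) (hy : y ∈ U) (j : Fin n) :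
    DifferentiableAt ℝ (fun z => N z j) y :=
  ((h.contDiffOn_apply j).differentiableOn (by norm_num)).differentiableAt (h.isOpen.mem_nhds hy)

theorem contDiffOn_tproj (h : IsNormalField N U) (i : Fin n) : ContDiffOn ℝ 3 (tproj N i) U :=
  contDiffOn_const.sub ((h.contDiffOn_apply i).smul h.contDiffOn)

theorem contDiffOn_tderiv (h : IsNormalField N U) {f : EuclideanSpace ℝ (Fin n) → ℝ}
    {m k : WithTop ℕ∞} (hf : ContDiffOn ℝ k f U) (hmk : m + 1 ≤ k) (hm : m ≤ 3) (i : Fin n) :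
    ContDiffOn ℝ m (tderiv N i f) U :=
  (hf.fderiv_of_isOpen h.isOpen hmk).clm_apply ((h.contDiffOn_tproj i).of_le hm)

theorem contDiffOn_sff (h : IsNormalField N U) (i j : Fin n) : ContDiffOn ℝ 2 (sff N i j) U :=
  h.contDiffOn_tderiv (h.contDiffOn_apply j) (by norm_num) (by norm_num) i

theorem differentiableAt_sff (h : IsNormalField N U) (hy : y ∈ U) (i j : Fin n) :
    DifferentiableAt ℝ (sff N i j) y :=
  ((h.contDiffOn_sff i j).differentiableOn (by norm_num)).differentiableAt (h.isOpen.mem_nhds hy)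

theorem differentiableAt_tderiv_sff (h : IsNormalField N U) (hy : y ∈ U) (i j k : Fin n) :
    DifferentiableAt ℝ (tderiv N k (sff N i j)) y :=
  ((h.contDiffOn_tderiv (m := 1) (h.contDiffOn_sff i j) (by norm_num)
    (by norm_num) k).differentiableOn (by norm_num)).differentiableAt (h.isOpen.mem_nhds hy)

theorem differentiableAt_sffSq (h : IsNormalField N U) (hy : y ∈ U) (i j : Fin n) :
    DifferentiableAt ℝ (sffSq N i j) y :=
  DifferentiableAt.fun_sum fun b _ =>
    (h.differentiableAt_sff hy i b).fun_mul (h.differentiableAt_sff hy b j)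

theorem sum_mul_self (h : IsNormalField N U) (hy : y ∈ U) : ∑ j, N y j * N y j = 1 := by
  have h1 := EuclideanSpace.real_norm_sq_eq (N y)
  rw [h.norm_eq_one y hy] at h1
  simpa [sq] using h1.symm

theorem inner_tproj (h : IsNormalField N U) (hy : y ∈ U) (i : Fin n) : ⟪N y, tproj N i y⟫ = 0 := by
  rw [tproj, inner_sub_right, real_inner_smul_right, real_inner_self_eq_norm_sq,
    h.norm_eq_one y hy]
  simp [EuclideanSpace.inner_single_right]

theorem eventually_mem (h : IsNormalField N U) (hy : y ∈ U) : ∀ᶠ z in 𝓝 y, z ∈ U :=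
  h.isOpen.mem_nhds hy

theorem inner_fderiv_self (h : IsNormalField N U) (hy : y ∈ U) (v : EuclideanSpace ℝ (Fin n)) :
    ⟪fderiv ℝ N y v, N y⟫ = 0 := by
  have h1 : HasFDerivAt (fun z => ⟪N z, N z⟫) _ y :=
    (h.differentiableAt hy).hasFDerivAt.inner ℝ (h.differentiableAt hy).hasFDerivAt
  have h2 : (fun z => ⟪N z, N z⟫) =ᶠ[𝓝 y] fun _ => (1 : ℝ) := by
    filter_upwards [h.eventually_mem hy] with z hz
    rw [real_inner_self_eq_norm_sq, h.norm_eq_one z hz, one_pow]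
  have h3 := congrArg (fun L => L v)
    ((h1.congr_of_eventuallyEq h2.symm).unique (hasFDerivAt_const (1 : ℝ) y))
  simp only [ContinuousLinearMap.comp_apply, ContinuousLinearMap.prod_apply,
    fderivInnerCLM_apply, zero_apply] at h3
  rw [real_inner_comm] at h3
  linarith

theorem fderiv_apply_eq (h : IsNormalField N U) (hy : y ∈ U) (v : EuclideanSpace ℝ (Fin n))
    (j : Fin n) : fderiv ℝ (fun z => N z j) y v = (fderiv ℝ N y v) j := by
  have h1 : HasFDerivAt (fun z => N z j) _ y :=
    (EuclideanSpace.proj (𝕜 := ℝ) j).hasFDerivAt.comp y (h.differentiableAt hy).hasFDerivAt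
  rw [h1.fderiv]
  rfl

theorem sff_eq (h : IsNormalField N U) (hy : y ∈ U) (i j : Fin n) :
    sff N i j y = (fderiv ℝ N y (tproj N i y)) j :=
  h.fderiv_apply_eq hy _ j

theorem sff_comm (h : IsNormalField N U) (hy : y ∈ U) (i j : Fin n) :
    sff N i j y = sff N j i y := by
  have key : ∀ i j, sff N i j y = ⟪fderiv ℝ N y (tproj N i y), tproj N j y⟫ := by
    intro i j
    rw [h.sff_eq hy, tproj.eq_1 N j, inner_sub_right, real_inner_smul_right,
      h.inner_fderiv_self hy]
    simp [EuclideanSpace.inner_single_right]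
  rw [key i j, key j i]
  exact h.inner_fderiv_comm y hy _ _ (h.inner_tproj hy i) (h.inner_tproj hy j)

theorem sum_sff_mul_normal (h : IsNormalField N U) (hy : y ∈ U) (i : Fin n) :
    ∑ j, sff N i j y * N y j = 0 := by
  have h1 := h.inner_fderiv_self hy (tproj N i y)
  rw [PiLp.inner_apply] at h1
  simpa [h.sff_eq hy, mul_comm] using h1

theorem sum_normal_mul_sff (h : IsNormalField N U) (hy : y ∈ U) (i : Fin n) :
    ∑ j, N y j * sff N j i y = 0 := by
  rw [← h.sum_sff_mul_normal hy i]
  exact Finset.sum_congr rfl fun j _ => by rw [h.sff_comm hy j i, mul_comm]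

theorem sum_single (v : EuclideanSpace ℝ (Fin n)) :
    ∑ k, v k • EuclideanSpace.single k (1 : ℝ) = v := by
  ext j
  simp [Finset.sum_apply, Pi.single_apply]

theorem sum_normal_mul_tderiv (h : IsNormalField N U) (hy : y ∈ U)
    (f : EuclideanSpace ℝ (Fin n) → ℝ) : ∑ k, N y k * tderiv N k f y = 0 := by
  have h1 : ∑ k, N y k • tproj N k y = 0 := by
    simp only [tproj, smul_sub, Finset.sum_sub_distrib, smul_smul, ← Finset.sum_smul,
      h.sum_mul_self hy, sum_single, one_smul, sub_self]
  have h2 := congrArg (fderiv ℝ f y) h1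
  simpa [map_sum, tderiv] using h2

/-- The commutator of two tangential derivatives. -/
theorem tderiv_comm (h : IsNormalField N U) (hy : y ∈ U) {f : EuclideanSpace ℝ (Fin n) → ℝ}
    (hf : ContDiffOn ℝ 2 f U) (i j : Fin n) :
    tderiv N i (tderiv N j f) y = tderiv N j (tderiv N i f) y
      + ∑ b, (N y i * sff N j b y - N y j * sff N i b y) * tderiv N b f y := by
  have hD : DifferentiableAt ℝ (fderiv ℝ f) y :=
    ((hf.fderiv_of_isOpen (m := 1) h.isOpen (by norm_num)).differentiableOn
      one_ne_zero).differentiableAt (h.isOpen.mem_nhds hy)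
  have hsymm := (hf.contDiffAt (h.isOpen.mem_nhds hy)).isSymmSndFDerivAt (by simp)
  -- The Hessian term and the A_ij term are symmetric in i and j, so the commutator comes from the
  -- last term alone.
  have key : ∀ i j, tderiv N i (tderiv N j f) y
      = fderiv ℝ (fderiv ℝ f) y (tproj N i y) (tproj N j y)
        - (sff N i j y * fderiv ℝ f y (N y)
          + N y j * fderiv ℝ f y (fderiv ℝ N y (tproj N i y))) := by
    intro i j
    have h1 : HasFDerivAt (tproj N j) _ y :=
      (((h.differentiableAt_apply hy j).hasFDerivAt.smul
        (h.differentiableAt hy).hasFDerivAt).const_sub (EuclideanSpace.single j (1 : ℝ)))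
    have h2 : HasFDerivAt (tderiv N j f) _ y := hD.hasFDerivAt.clm_apply h1
    rw [tderiv, h2.fderiv]
    simp [sff, tderiv, map_smul]
    ring
  have key2 : ∀ j, fderiv ℝ f y (fderiv ℝ N y (tproj N j y))
      = ∑ b, sff N j b y * tderiv N b f y := by
    intro j
    -- Coordinate vectors may be replaced by their projections because A N = 0.
    have h3 : fderiv ℝ N y (tproj N j y) = ∑ b, sff N j b y • tproj N b y := by
      simp only [tproj.eq_1 N, smul_sub, Finset.sum_sub_distrib, smul_smul, ← Finset.sum_smul,
        h.sum_sff_mul_normal hy j, zero_smul, sub_zero]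
      rw [← sum_single (fderiv ℝ N y _)]
      exact Finset.sum_congr rfl fun b _ => by rw [h.sff_eq hy]; rfl
    rw [h3, map_sum]
    simp [tderiv]
  rw [key i j, key j i, key2, key2, hsymm.eq, h.sff_comm hy i j]
  simp only [sub_mul, Finset.sum_sub_distrib, mul_assoc, ← Finset.mul_sum]
  ring

/-- This is the commutator formula applied to the component N_j. -/
theorem codazzi (h : IsNormalField N U) (hy : y ∈ U) (i j k : Fin n) :
    tderiv N k (sff N i j) y = tderiv N i (sff N k j) y
      + (N y k * sffSq N i j y - N y i * sffSq N k j y) := by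
  have h1 := h.tderiv_comm hy ((h.contDiffOn_apply j).of_le (by norm_num)) k i
  simp only [← sff.eq_1] at h1
  rw [h1, sffSq, sffSq, Finset.mul_sum, Finset.mul_sum, ← Finset.sum_sub_distrib]
  congr 1
  exact Finset.sum_congr rfl fun b _ => by ring

theorem tderiv_sff_comm (h : IsNormalField N U) (hy : y ∈ U) (i j k : Fin n) :
    tderiv N k (sff N i j) y = tderiv N k (sff N j i) y :=
  tderiv_congr k ((h.eventually_mem hy).mono fun _ hz => h.sff_comm hz i j)

theorem sffSq_comm (h : IsNormalField N U) (hy : y ∈ U) (i j : Fin n) :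
    sffSq N i j y = sffSq N j i y :=
  Finset.sum_congr rfl fun b _ => by rw [h.sff_comm hy i b, h.sff_comm hy b j, mul_comm]

theorem sum_sffSq_mul_normal (h : IsNormalField N U) (hy : y ∈ U) (i : Fin n) :
    ∑ j, N y j * sffSq N j i y = 0 := by
  simp only [sffSq, Finset.mul_sum]
  rw [Finset.sum_comm]
  refine Finset.sum_eq_zero fun b _ => ?_
  rw [← zero_mul (sff N b i y), ← h.sum_normal_mul_sff hy b, Finset.sum_mul]
  exact Finset.sum_congr rfl fun j _ => by ring

/-- Apply δ_k to A N = 0, which holds on all of U. -/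
theorem sum_tderiv_sff_mul_normal (h : IsNormalField N U) (hy : y ∈ U) (i k : Fin n) :
    ∑ j, tderiv N k (sff N i j) y * N y j = -sffSq N k i y := by
  have h1 : tderiv N k (fun z => ∑ j, sff N i j z * N z j) y = 0 := by
    rw [tderiv_congr k ((h.eventually_mem hy).mono fun _ hz => h.sum_sff_mul_normal hz i),
      tderiv_const]
  rw [tderiv_sum_mul _ k (h.differentiableAt_sff hy i) (h.differentiableAt_apply hy),
    Finset.sum_add_distrib] at h1
  rw [eq_neg_iff_add_eq_zero, ← h1, sffSq]
  congr 1
  exact Finset.sum_congr rfl fun b _ => by rw [h.sff_comm hy i b, mul_comm]; rfl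

end IsNormalField

end ConeGeometry

namespace ConeGeometry

/-! ### Simons' identity -/

variable {n : ℕ} {U : Set (EuclideanSpace ℝ (Fin n))}
  {N : EuclideanSpace ℝ (Fin n) → EuclideanSpace ℝ (Fin n)}
  {y : EuclideanSpace ℝ (Fin n)}

/-- The trace of the second fundamental form. -/
noncomputable def sffTrace (N : EuclideanSpace ℝ (Fin n) → EuclideanSpace ℝ (Fin n))
    (y : EuclideanSpace ℝ (Fin n)) : ℝ :=
  ∑ k, sff N k k y

/-- The squared norm of the second fundamental form. -/
noncomputable def sffNormSq (N : EuclideanSpace ℝ (Fin n) → EuclideanSpace ℝ (Fin n))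
    (y : EuclideanSpace ℝ (Fin n)) : ℝ :=
  ∑ i, ∑ j, sff N i j y * sff N i j y

namespace IsNormalField

theorem contDiffOn_sffTrace (h : IsNormalField N U) : ContDiffOn ℝ 2 (sffTrace N) U :=
  ContDiffOn.sum fun k _ => h.contDiffOn_sff k k

theorem contDiffOn_sffNormSq (h : IsNormalField N U) : ContDiffOn ℝ 2 (sffNormSq N) U :=
  ContDiffOn.sum fun i _ => ContDiffOn.sum fun j _ => (h.contDiffOn_sff i j).mul
    (h.contDiffOn_sff i j)

theorem differentiableAt_sffNormSq (h : IsNormalField N U) (hy : y ∈ U) :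
    DifferentiableAt ℝ (sffNormSq N) y :=
  (h.contDiffOn_sffNormSq.differentiableOn (by norm_num)).differentiableAt (h.isOpen.mem_nhds hy)

theorem differentiableAt_tderiv (h : IsNormalField N U) (hy : y ∈ U)
    {f : EuclideanSpace ℝ (Fin n) → ℝ} (hf : ContDiffOn ℝ 2 f U) (j : Fin n) :
    DifferentiableAt ℝ (tderiv N j f) y :=
  ((h.contDiffOn_tderiv (m := 1) hf (by norm_num) (by norm_num) j).differentiableOn
    one_ne_zero).differentiableAt (h.isOpen.mem_nhds hy)

theorem sum_sffSq_self (h : IsNormalField N U) (hy : y ∈ U) :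
    ∑ k, sffSq N k k y = sffNormSq N y :=
  Finset.sum_congr rfl fun i _ => Finset.sum_congr rfl fun j _ => by rw [h.sff_comm hy j i]

/-- The Codazzi equation traced, with A² N = 0 removing one of its two normal terms. -/
theorem sum_tderiv_sff (h : IsNormalField N U) (hy : y ∈ U) (j : Fin n) :
    ∑ k, tderiv N k (sff N k j) y = tderiv N j (sffTrace N) y - N y j * sffNormSq N y := by
  have h1 : ∀ k, tderiv N k (sff N k j) y = tderiv N j (sff N k k) y
      + (N y k * sffSq N k j y - N y j * sffSq N k k y) := by
    intro k
    rw [h.tderiv_sff_comm hy, h.codazzi hy, h.sffSq_comm hy j k]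
  have h2 : tderiv N j (sffTrace N) y = ∑ k, tderiv N j (sff N k k) y :=
    tderiv_sum _ j fun k _ => h.differentiableAt_sff hy k k
  rw [h2, Finset.sum_congr rfl fun k _ => h1 k, Finset.sum_add_distrib, Finset.sum_sub_distrib,
    h.sum_sffSq_mul_normal hy, ← Finset.mul_sum, h.sum_sffSq_self hy]
  ring

/-- Simons' identity for the Laplacian of the second fundamental form, up to normal components. -/
theorem exists_sum_tderiv_tderiv_sff (h : IsNormalField N U) (hy : y ∈ U) :
    ∃ X Y : Fin n → ℝ, ∀ i j, ∑ k, tderiv N k (tderiv N k (sff N i j)) y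
      = tderiv N i (tderiv N j (sffTrace N)) y + sffTrace N y * sffSq N i j y
        - sffNormSq N y * sff N i j y - 2 * ∑ b, sff N i b y * sffSq N b j y
        + N y j * X i + N y i * Y j := by
  -- The witnesses collect all terms with a free factor N_j or N_i. Their values play no role later,
  -- since A N = 0.
  refine ⟨fun i => -tderiv N i (sffNormSq N) y, fun j => -(∑ k, ∑ b, sff N k b y *
    tderiv N b (sff N k j) y + ∑ k, tderiv N k (sffSq N k j) y), fun i j => ?_⟩
  have dN := h.differentiableAt_apply hy
  have dS := h.differentiableAt_sffSq hy
  -- Differentiate the Codazzi equation, then commute δ_k past δ_i so that the trace over k can be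
  -- taken inside.
  have h1 : ∀ k, tderiv N k (tderiv N k (sff N i j)) y
      = tderiv N i (tderiv N k (sff N k j)) y
        + ∑ b, (N y k * sff N i b y - N y i * sff N k b y) * tderiv N b (sff N k j) y
        + (sff N k k y * sffSq N i j y + N y k * tderiv N k (sffSq N i j) y
          - (sff N k i y * sffSq N k j y + N y i * tderiv N k (sffSq N k j) y)) := by
    intro k
    rw [tderiv_congr k ((h.eventually_mem hy).mono fun _ hz => h.codazzi hz i j k),
      tderiv_add k (h.differentiableAt_tderiv_sff hy k j i)
        (((dN k).fun_mul (dS i j)).fun_sub ((dN i).fun_mul (dS k j))),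
      tderiv_sub k ((dN k).fun_mul (dS i j)) ((dN i).fun_mul (dS k j)),
      tderiv_mul k (dN k) (dS i j), tderiv_mul k (dN i) (dS k j),
      h.tderiv_comm hy (h.contDiffOn_sff k j)]
    rfl
  have h2 : ∑ k, tderiv N i (tderiv N k (sff N k j)) y = tderiv N i (tderiv N j (sffTrace N)) y
      - (sff N i j y * sffNormSq N y + N y j * tderiv N i (sffNormSq N) y) := by
    rw [← tderiv_sum _ i fun k _ => h.differentiableAt_tderiv_sff hy k j k,
      tderiv_congr i ((h.eventually_mem hy).mono fun _ hz => h.sum_tderiv_sff hz j),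
      tderiv_sub i (h.differentiableAt_tderiv hy h.contDiffOn_sffTrace j)
        ((dN j).fun_mul (h.differentiableAt_sffNormSq hy)),
      tderiv_mul i (dN j) (h.differentiableAt_sffNormSq hy)]
    rfl
  -- The commutator term here and the Codazzi term in `h4` each contribute −A·A², whence the
  -- coefficient 2.
  have h3 : ∑ k, ∑ b, N y k * sff N i b y * tderiv N b (sff N k j) y
      = -∑ b, sff N i b y * sffSq N b j y := by
    rw [Finset.sum_comm, ← Finset.sum_neg_distrib]
    refine Finset.sum_congr rfl fun b _ => ?_
    rw [← mul_neg, ← h.sum_tderiv_sff_mul_normal hy j b, Finset.mul_sum]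
    refine Finset.sum_congr rfl fun k _ => ?_
    rw [h.tderiv_sff_comm hy k j b]
    ring
  have h4 : ∑ k, sff N k i y * sffSq N k j y = ∑ b, sff N i b y * sffSq N b j y :=
    Finset.sum_congr rfl fun b _ => by rw [h.sff_comm hy b i]
  rw [Finset.sum_congr rfl fun k _ => h1 k]
  simp only [sub_mul, Finset.sum_add_distrib, Finset.sum_sub_distrib]
  rw [h2, h3, h4, h.sum_normal_mul_tderiv hy, ← Finset.sum_mul, ← sffTrace]
  simp only [mul_assoc, ← Finset.mul_sum]
  ring

theorem tderiv_sffNormSq (h : IsNormalField N U) (hy : y ∈ U) (k : Fin n) :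
    tderiv N k (sffNormSq N) y = ∑ i, ∑ j, (2 * sff N i j y) * tderiv N k (sff N i j) y := by
  have dA := h.differentiableAt_sff hy
  have e : tderiv N k (sffNormSq N) y
      = ∑ i, tderiv N k (fun w => ∑ j, sff N i j w * sff N i j w) y :=
    tderiv_sum _ k fun i _ => DifferentiableAt.fun_sum fun j _ => (dA i j).fun_mul (dA i j)
  rw [e]
  refine Finset.sum_congr rfl fun i _ => ?_
  rw [tderiv_sum_mul _ k (dA i) (dA i)]
  exact Finset.sum_congr rfl fun j _ => by ring

/-- Simons' identity for the squared norm of the second fundamental form. -/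
theorem sum_tderiv_tderiv_sffNormSq (h : IsNormalField N U) (hy : y ∈ U)
    (hH : sffTrace N y = 0) (hdH : ∀ i j, tderiv N i (tderiv N j (sffTrace N)) y = 0) :
    ∑ k, tderiv N k (tderiv N k (sffNormSq N)) y
      = 2 * (∑ k, ∑ i, ∑ j, tderiv N k (sff N i j) y ^ 2 - sffNormSq N y ^ 2
        - 2 * ∑ i, ∑ j, sffSq N i j y ^ 2) := by
  have dA := h.differentiableAt_sff hy
  have h2 : ∀ k, tderiv N k (tderiv N k (sffNormSq N)) y
      = ∑ i, ∑ j, (2 * tderiv N k (sff N i j) y ^ 2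
        + 2 * sff N i j y * tderiv N k (tderiv N k (sff N i j)) y) := by
    intro k
    have d2 : ∀ i j, DifferentiableAt ℝ (fun z => 2 * sff N i j z) y :=
      fun i j => (dA i j).const_mul 2
    have dB := fun i j => h.differentiableAt_tderiv_sff hy i j k
    rw [tderiv_congr k ((h.eventually_mem hy).mono fun _ hz => h.tderiv_sffNormSq hz k),
      tderiv_sum _ k fun i _ => DifferentiableAt.fun_sum fun j _ => (d2 i j).fun_mul (dB i j)]
    refine Finset.sum_congr rfl fun i _ => ?_
    rw [tderiv_sum_mul _ k (d2 i) (dB i)]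
    refine Finset.sum_congr rfl fun j _ => ?_
    rw [tderiv_mul k (differentiableAt_const 2) (dA i j), tderiv_const]
    ring
  obtain ⟨X, Y, hXY⟩ := h.exists_sum_tderiv_tderiv_sff hy
  have h3 : ∑ i, ∑ j, sff N i j y * ∑ k, tderiv N k (tderiv N k (sff N i j)) y
      = -sffNormSq N y ^ 2 - 2 * ∑ i, ∑ j, sffSq N i j y ^ 2 := by
    have e1 : ∑ i, ∑ j, sff N i j y * ∑ b, sff N i b y * sffSq N b j y
        = ∑ i, ∑ j, sffSq N i j y ^ 2 := by
      have e : ∀ b j, sffSq N b j y ^ 2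
          = ∑ i, sff N i j y * (sff N i b y * sffSq N b j y) := by
        intro b j
        rw [sq]
        nth_rewrite 1 [sffSq]
        rw [Finset.sum_mul]
        exact Finset.sum_congr rfl fun i _ => by rw [h.sff_comm hy b i]; ring
      simp only [e, Finset.mul_sum]
      rw [Finset.sum_congr rfl fun i _ => Finset.sum_comm, Finset.sum_comm]
      exact Finset.sum_congr rfl fun b _ => Finset.sum_comm
    have e2 : ∑ i, ∑ j, sff N i j y * (N y j * X i) = 0 := by
      refine Finset.sum_eq_zero fun i _ => ?_
      rw [← zero_mul (X i), ← h.sum_sff_mul_normal hy i, Finset.sum_mul]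
      exact Finset.sum_congr rfl fun j _ => by ring
    have e3 : ∑ i, ∑ j, sff N i j y * (N y i * Y j) = 0 := by
      rw [Finset.sum_comm]
      refine Finset.sum_eq_zero fun j _ => ?_
      rw [← zero_mul (Y j), ← h.sum_normal_mul_sff hy j, Finset.sum_mul]
      exact Finset.sum_congr rfl fun i _ => by ring
    have e4 : ∀ i j, sff N i j y * ∑ k, tderiv N k (tderiv N k (sff N i j)) y
        = sff N i j y * (N y j * X i) + sff N i j y * (N y i * Y j)
          - sffNormSq N y * (sff N i j y * sff N i j y)
          - 2 * (sff N i j y * ∑ b, sff N i b y * sffSq N b j y) := by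
      intro i j
      rw [hXY, hH, hdH]
      ring
    simp only [e4, Finset.sum_add_distrib, Finset.sum_sub_distrib, ← Finset.mul_sum]
    rw [e1, e2, e3, ← sffNormSq]
    ring
  have h4 : ∑ k, ∑ i, ∑ j, sff N i j y * tderiv N k (tderiv N k (sff N i j)) y
      = ∑ i, ∑ j, sff N i j y * ∑ k, tderiv N k (tderiv N k (sff N i j)) y := by
    simp only [Finset.mul_sum]
    rw [Finset.sum_comm]
    exact Finset.sum_congr rfl fun i _ => Finset.sum_comm
  simp only [h2, mul_assoc, Finset.sum_add_distrib, ← Finset.mul_sum]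
  rw [h4, h3]
  ring

end IsNormalField

/-! ### The refined Cauchy-Schwarz inequality on a cone -/

/-- The rank-two term is chosen so that the corrected matrix annihilates u. The cross terms give
−4s⁻¹|a|² and the square of the correction 2s⁻¹|a|². -/
theorem sum_sq_add_rankTwo {B : Fin n → Fin n → ℝ} {u a : Fin n → ℝ} {s : ℝ} (hs : s ≠ 0)
    (hu : ∑ i, u i * u i = s) (hB : ∀ i j, B i j = B j i) (hBu : ∀ i, ∑ j, B i j * u j = -a i)
    (hua : ∑ i, u i * a i = 0) :
    ∑ i, ∑ j, (B i j + s⁻¹ * (u i * a j + a i * u j)) ^ 2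
      = ∑ i, ∑ j, B i j ^ 2 - 2 * s⁻¹ * ∑ i, a i ^ 2 := by
  have e1 : ∑ i, ∑ j, a i * (B i j * u j) = -∑ i, a i ^ 2 := by
    simp only [← Finset.mul_sum, hBu, ← Finset.sum_neg_distrib]
    exact Finset.sum_congr rfl fun i _ => by ring
  have e2 : ∑ i, ∑ j, a j * (B i j * u i) = -∑ i, a i ^ 2 := by
    rw [← e1, Finset.sum_comm]
    exact Finset.sum_congr rfl fun i _ => Finset.sum_congr rfl fun j _ => by rw [hB]
  have e3 : ∑ i, ∑ j, (u i * u i) * a j ^ 2 = s * ∑ i, a i ^ 2 := by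
    simp only [← Finset.mul_sum, ← Finset.sum_mul, hu]
  have e4 : ∑ i, ∑ j, a i ^ 2 * (u j * u j) = s * ∑ i, a i ^ 2 := by
    simp only [← Finset.mul_sum, ← Finset.sum_mul, hu]
    ring
  have e5 : ∑ i, ∑ j, (u i * a i) * (u j * a j) = 0 := by
    simp only [← Finset.mul_sum, hua, mul_zero, Finset.sum_const_zero]
  have e6 : ∀ i j, (B i j + s⁻¹ * (u i * a j + a i * u j)) ^ 2
      = B i j ^ 2 + 2 * s⁻¹ * (a i * (B i j * u j)) + 2 * s⁻¹ * (a j * (B i j * u i))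
        + s⁻¹ ^ 2 * ((u i * u i) * a j ^ 2) + s⁻¹ ^ 2 * (a i ^ 2 * (u j * u j))
        + 2 * s⁻¹ ^ 2 * ((u i * a i) * (u j * a j)) := fun i j => by ring
  simp only [e6, Finset.sum_add_distrib, ← Finset.mul_sum]
  simp only [← Finset.mul_sum] at e1 e2 e3 e4 e5 ⊢
  rw [e1, e2, e3, e4, e5]
  field_simp
  ring

end ConeGeometry

namespace ConeGeometry

variable {n : ℕ} {U E : Set (EuclideanSpace ℝ (Fin n))}
  {N : EuclideanSpace ℝ (Fin n) → EuclideanSpace ℝ (Fin n)}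
  {φ : EuclideanSpace ℝ (Fin n) → ℝ} {k : WithTop ℕ∞}
  {x y : EuclideanSpace ℝ (Fin n)}

/-- Cauchy-Schwarz for `A : B` when `A` annihilates two orthogonal vectors, improved by the action
of `B` on these vectors. -/
theorem sq_sum_mul_le_of_annihilates {A B : Fin n → Fin n → ℝ} {u v a b : Fin n → ℝ} {s : ℝ}
    (hs : s ≠ 0) (hu : ∑ i, u i * u i = s) (hv : ∑ i, v i * v i = 1) (huv : ∑ i, u i * v i = 0)
    (hA : ∀ i j, A i j = A j i) (hAu : ∀ i, ∑ j, A i j * u j = 0)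
    (hAv : ∀ i, ∑ j, A i j * v j = 0) (hB : ∀ i j, B i j = B j i)
    (hBu : ∀ i, ∑ j, B i j * u j = -a i) (hBv : ∀ i, ∑ j, B i j * v j = -b i)
    (hua : ∑ i, u i * a i = 0) (hva : ∑ i, v i * a i = 0) (hvb : ∑ i, v i * b i = 0) :
    (∑ i, ∑ j, A i j * B i j) ^ 2 ≤ (∑ i, ∑ j, A i j * A i j)
      * (∑ i, ∑ j, B i j ^ 2 - 2 * s⁻¹ * ∑ i, a i ^ 2 - 2 * ∑ i, b i ^ 2) := by
  -- C corrects B along u, and D then corrects C along v. As v is orthogonal to u and a, the first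
  -- correction leaves the action on v unchanged.
  set C : Fin n → Fin n → ℝ := fun i j => B i j + s⁻¹ * (u i * a j + a i * u j) with hC
  set D : Fin n → Fin n → ℝ := fun i j => C i j + (1 : ℝ)⁻¹ * (v i * b j + b i * v j) with hD
  have hCsymm : ∀ i j, C i j = C j i := fun i j => by simp only [hC, hB i j]; ring
  have hCv : ∀ i, ∑ j, C i j * v j = -b i := by
    intro i
    have e : ∀ j, C i j * v j
        = B i j * v j + s⁻¹ * u i * (v j * a j) + s⁻¹ * a i * (u j * v j) := fun j => by
      simp only [hC]; ring
    simp only [e, Finset.sum_add_distrib, ← Finset.mul_sum, hBv, hva, huv]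
    ring
  have hDsq : ∑ i, ∑ j, D i j ^ 2
      = ∑ i, ∑ j, B i j ^ 2 - 2 * s⁻¹ * ∑ i, a i ^ 2 - 2 * ∑ i, b i ^ 2 := by
    rw [sum_sq_add_rankTwo one_ne_zero hv hCsymm hCv hvb,
      sum_sq_add_rankTwo hs hu hB hBu hua]
    norm_num
  have hcross : ∀ w c : Fin n → ℝ, (∀ i, ∑ j, A i j * w j = 0) →
      ∑ i, ∑ j, A i j * (w i * c j + c i * w j) = 0 := by
    intro w c hw
    have e1 : ∑ i, ∑ j, c i * (A i j * w j) = 0 := by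
      simp only [← Finset.mul_sum, hw, mul_zero, Finset.sum_const_zero]
    have e2 : ∑ i, ∑ j, c j * (A i j * w i) = 0 := by
      rw [← e1, Finset.sum_comm]
      exact Finset.sum_congr rfl fun i _ => Finset.sum_congr rfl fun j _ => by rw [hA]
    have e3 : ∀ i j, A i j * (w i * c j + c i * w j)
        = c j * (A i j * w i) + c i * (A i j * w j) := fun i j => by ring
    simp only [e3, Finset.sum_add_distrib]
    rw [e1, e2, add_zero]
  -- Every correction term has a factor u or v, which A annihilates.
  have hAD : ∑ i, ∑ j, A i j * D i j = ∑ i, ∑ j, A i j * B i j := by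
    have e : ∀ i j, A i j * D i j = A i j * B i j + s⁻¹ * (A i j * (u i * a j + a i * u j))
        + A i j * (v i * b j + b i * v j) := fun i j => by simp only [hD, hC, inv_one]; ring
    simp only [e, Finset.sum_add_distrib]
    simp only [← Finset.mul_sum]
    rw [hcross u a hAu, hcross v b hAv]
    ring
  rw [← hAD, ← hDsq]
  have h := Finset.sum_mul_sq_le_sq_mul_sq (Finset.univ : Finset (Fin n × Fin n))
    (fun p => A p.1 p.2) (fun p => D p.1 p.2)
  simp only [Fintype.sum_prod_type] at h
  simpa only [sq] using h

theorem tderiv_apply (i j : Fin n) : tderiv N i (fun z => z j) y = tproj N i y j := by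
  have h1 : HasFDerivAt (fun z : EuclideanSpace ℝ (Fin n) => z j) _ y :=
    (EuclideanSpace.proj (𝕜 := ℝ) j).hasFDerivAt
  rw [tderiv, h1.fderiv]
  rfl

theorem tproj_apply (i j : Fin n) : tproj N i y j = (if j = i then 1 else 0) - N y i * N y j := by
  simp [tproj]

/-! ### Boundary operators in ambient coordinates. -/

namespace IsDefiningFunction

theorem tangentialDeriv_single_eq_tderiv (h : IsDefiningFunction k E U φ) (hk : 1 ≤ k) (hy : y ∈ U)
    (hyE : y ∈ frontier E) {f f₁ : EuclideanSpace ℝ (Fin n) → ℝ}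
    (hf : ∀ z ∈ U, z ∈ frontier E → f z = f₁ z) (hf₁ : DifferentiableAt ℝ f₁ y) (j : Fin n) :
    tangentialDeriv E f y (EuclideanSpace.single j 1) = tderiv (unitGradient φ) j f₁ y := by
  rw [h.tangentialDeriv_eq_fderiv hk hy hyE hf hf₁, tderiv, tproj]
  simp [EuclideanSpace.inner_single_right]

/-- Tangential derivatives see only boundary values. This allows relations valid on the boundary
alone, such as those from the cone or from H = 0, to be differentiated. -/
theorem tderiv_eq_zero (h : IsDefiningFunction k E U φ) (hk : 1 ≤ k) (hy : y ∈ U)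
    (hyE : y ∈ frontier E) {f : EuclideanSpace ℝ (Fin n) → ℝ}
    (hf : ∀ z ∈ U, z ∈ frontier E → f z = 0) (hfd : DifferentiableAt ℝ f y) (j : Fin n) :
    tderiv (unitGradient φ) j f y = 0 := by
  rw [← h.tangentialDeriv_single_eq_tderiv hk hy hyE (f := fun _ => 0)
    (fun z hz hzE => (hf z hz hzE).symm) hfd,
    h.tangentialDeriv_single_eq_tderiv hk hy hyE (f₁ := fun _ => 0) (fun _ _ _ => rfl)
      (differentiableAt_const 0), tderiv_const]

theorem tangentialDeriv_exteriorNormal (h : IsDefiningFunction k E U φ) (hk : 4 ≤ k) (hy : y ∈ U)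
    (hyE : y ∈ frontier E) (i j : Fin n) :
    tangentialDeriv E (exteriorNormal E) y (EuclideanSpace.single j 1) i
      = sff (unitGradient φ) j i y := by
  have hk1 : 1 ≤ k := le_trans (by norm_num) hk
  rw [h.tangentialDeriv_eq_fderiv hk1 hy hyE (fun z hz hzE => h.exteriorNormal_eq hk1 hz hzE)
    ((h.isNormalField hk).differentiableAt hy), (h.isNormalField hk).sff_eq hy, tproj]
  simp [EuclideanSpace.inner_single_right]

theorem meanCurvature_eq (h : IsDefiningFunction k E U φ) (hk : 4 ≤ k) (hy : y ∈ U)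
    (hyE : y ∈ frontier E) : meanCurvature E y = sffTrace (unitGradient φ) y := by
  rw [meanCurvature, tangentialDiv, sffTrace]
  exact Finset.sum_congr rfl fun i _ => h.tangentialDeriv_exteriorNormal hk hy hyE i i

theorem secondFormNorm_eq (h : IsDefiningFunction k E U φ) (hk : 4 ≤ k) (hy : y ∈ U)
    (hyE : y ∈ frontier E) : secondFormNorm E y = √(sffNormSq (unitGradient φ) y) := by
  rw [secondFormNorm]
  congr 1
  refine Finset.sum_congr rfl fun i _ => Finset.sum_congr rfl fun j _ => ?_
  rw [h.tangentialDeriv_exteriorNormal hk hy hyE, (h.isNormalField hk).sff_comm hy, sq]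

end IsDefiningFunction

theorem sffNormSq_nonneg (y : EuclideanSpace ℝ (Fin n)) : 0 ≤ sffNormSq N y :=
  Finset.sum_nonneg fun _ _ => Finset.sum_nonneg fun _ _ => mul_self_nonneg _

namespace IsDefiningFunction

theorem secondFormNorm_sq (h : IsDefiningFunction k E U φ) (hk : 4 ≤ k) (hy : y ∈ U)
    (hyE : y ∈ frontier E) : secondFormNorm E y ^ 2 = sffNormSq (unitGradient φ) y := by
  rw [h.secondFormNorm_eq hk hy hyE, Real.sq_sqrt (sffNormSq_nonneg y)]

theorem laplaceBeltrami_eq (h : IsDefiningFunction k E U φ) (hk : 4 ≤ k) (hy : y ∈ U)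
    (hyE : y ∈ frontier E) {f f₁ : EuclideanSpace ℝ (Fin n) → ℝ}
    (hf : ∀ z ∈ U, z ∈ frontier E → f z = f₁ z) (hf₁ : ContDiffOn ℝ 2 f₁ U) :
    laplaceBeltrami E f y
      = ∑ i, tderiv (unitGradient φ) i (tderiv (unitGradient φ) i f₁) y := by
  have hk1 : 1 ≤ k := le_trans (by norm_num) hk
  have hN := h.isNormalField hk
  set G : EuclideanSpace ℝ (Fin n) → EuclideanSpace ℝ (Fin n) :=
    fun z => WithLp.toLp 2 fun j => tderiv (unitGradient φ) j f₁ z with hG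
  have hgrad : ∀ z ∈ U, z ∈ frontier E → tangentialGradient E f z = G z := by
    intro z hz hzE
    ext j
    exact h.tangentialDeriv_single_eq_tderiv hk1 hz hzE hf
      ((hf₁.differentiableOn (by norm_num)).differentiableAt (h.isOpen.mem_nhds hz)) j
  have hGd : DifferentiableAt ℝ G y :=
    differentiableAt_euclidean.2 fun j => hN.differentiableAt_tderiv hy hf₁ j
  rw [laplaceBeltrami, tangentialDiv]
  refine Finset.sum_congr rfl fun i _ => ?_
  rw [h.tangentialDeriv_eq_fderiv hk1 hy hyE hgrad hGd]
  have h1 : HasFDerivAt (fun z => G z i) _ y :=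
    (EuclideanSpace.proj (𝕜 := ℝ) i).hasFDerivAt.comp y hGd.hasFDerivAt
  have h2 : tderiv (unitGradient φ) i (fun z => G z i) y
      = (fderiv ℝ G y (tproj (unitGradient φ) i y)) i := by
    rw [tderiv, h1.fderiv]
    rfl
  refine Eq.trans ?_ h2.symm
  simp [tproj, EuclideanSpace.inner_single_right]

/-- Apply δ_i to N · z = 0; the derivative of z is a tangential vector, orthogonal to N. -/
theorem sum_sff_mul_self (h : IsDefiningFunction k E U φ) (hk : 4 ≤ k) (hE : IsCone E) (hy : y ∈ U)
    (hyE : y ∈ frontier E) (i : Fin n) : ∑ j, sff (unitGradient φ) i j y * y j = 0 := by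
  have hk1 : 1 ≤ k := le_trans (by norm_num) hk
  have hN := h.isNormalField hk
  have dx : ∀ j, DifferentiableAt ℝ (fun z : EuclideanSpace ℝ (Fin n) => z j) y :=
    fun j => (EuclideanSpace.proj (𝕜 := ℝ) j).differentiableAt
  have h1 : tderiv (unitGradient φ) i (fun z => ∑ j, unitGradient φ z j * z j) y = 0 := by
    refine h.tderiv_eq_zero hk1 hy hyE (fun z hz hzE => ?_)
      (DifferentiableAt.fun_sum fun j _ => (hN.differentiableAt_apply hy j).fun_mul (dx j)) i
    have h2 := h.inner_self_eq_zero hk1 hE hz hzE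
    rw [PiLp.inner_apply] at h2
    simpa [mul_comm] using h2
  have h3 : ∑ j, unitGradient φ y j * tproj (unitGradient φ) i y j = 0 := by
    have h4 := hN.inner_tproj hy i
    rw [PiLp.inner_apply] at h4
    simpa [mul_comm] using h4
  rw [tderiv_sum_mul _ i (hN.differentiableAt_apply hy) dx, Finset.sum_add_distrib] at h1
  simp only [tderiv_apply, h3, add_zero] at h1
  exact h1

/-- Apply δ_l to A z = 0. This is the source of the term 2c²/|x|². -/
theorem sum_tderiv_sff_mul_self (h : IsDefiningFunction k E U φ) (hk : 4 ≤ k) (hE : IsCone E)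
    (hy : y ∈ U) (hyE : y ∈ frontier E) (i l : Fin n) :
    ∑ j, tderiv (unitGradient φ) l (sff (unitGradient φ) i j) y * y j
      = -sff (unitGradient φ) l i y := by
  have hk1 : 1 ≤ k := le_trans (by norm_num) hk
  have hN := h.isNormalField hk
  have dx : ∀ j, DifferentiableAt ℝ (fun z : EuclideanSpace ℝ (Fin n) => z j) y :=
    fun j => (EuclideanSpace.proj (𝕜 := ℝ) j).differentiableAt
  have h1 : tderiv (unitGradient φ) l (fun z => ∑ j, sff (unitGradient φ) i j z * z j) y = 0 :=
    h.tderiv_eq_zero hk1 hy hyE (fun z hz hzE => h.sum_sff_mul_self hk hE hz hzE i)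
      (DifferentiableAt.fun_sum fun j _ => (hN.differentiableAt_sff hy i j).fun_mul (dx j)) l
  have h3 : ∑ j, sff (unitGradient φ) i j y * tproj (unitGradient φ) l y j
      = sff (unitGradient φ) l i y := by
    have e : ∀ j, sff (unitGradient φ) i j y * tproj (unitGradient φ) l y j
        = (if j = l then sff (unitGradient φ) i j y else 0)
          - unitGradient φ y l * (sff (unitGradient φ) i j y * unitGradient φ y j) := by
      intro j
      rw [tproj_apply]
      split_ifs <;> ring
    simp only [e, Finset.sum_sub_distrib, ← Finset.mul_sum, hN.sum_sff_mul_normal hy,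
      Finset.sum_ite_eq', Finset.mem_univ, if_true, mul_zero, sub_zero]
    exact hN.sff_comm hy i l
  rw [tderiv_sum_mul _ l (hN.differentiableAt_sff hy i) dx, Finset.sum_add_distrib] at h1
  simp only [tderiv_apply, h3] at h1
  exact eq_neg_of_add_eq_zero_left h1

/-- The refined Kato inequality on a cone. -/
theorem sum_sq_sum_sff_mul_tderiv_le (h : IsDefiningFunction k E U φ) (hk : 4 ≤ k) (hE : IsCone E)
    (hy : y ∈ U) (hyE : y ∈ frontier E) (hy0 : y ≠ 0) :
    ∑ l, (∑ i, ∑ j, sff (unitGradient φ) i j y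
        * tderiv (unitGradient φ) l (sff (unitGradient φ) i j) y) ^ 2
      ≤ sffNormSq (unitGradient φ) y
        * (∑ l, ∑ i, ∑ j, tderiv (unitGradient φ) l (sff (unitGradient φ) i j) y ^ 2
          - 2 * sffNormSq (unitGradient φ) y / ‖y‖ ^ 2
          - 2 * ∑ i, ∑ j, sffSq (unitGradient φ) i j y ^ 2) := by
  have hN := h.isNormalField hk
  set N := unitGradient φ with hNdef
  have hs : ∑ i, y i * y i = ‖y‖ ^ 2 := by
    rw [EuclideanSpace.real_norm_sq_eq]
    exact Finset.sum_congr rfl fun i _ => (sq _).symm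
  have hyN : ∑ i, y i * N y i = 0 := by
    have h2 := h.inner_self_eq_zero (le_trans (by norm_num) hk) hE hy hyE
    rw [PiLp.inner_apply] at h2
    simpa using h2
  have hcomm : ∀ l (w : Fin n → ℝ), ∑ i, w i * sff N l i y = ∑ i, sff N l i y * w i :=
    fun l w => Finset.sum_congr rfl fun i _ => mul_comm _ _
  -- Cauchy-Schwarz for each fixed l, with u = y and v = N; a and b are the l-th rows of A and A².
  have key : ∀ l, (∑ i, ∑ j, sff N i j y * tderiv N l (sff N i j) y) ^ 2
      ≤ sffNormSq N y * (∑ i, ∑ j, tderiv N l (sff N i j) y ^ 2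
        - 2 * (‖y‖ ^ 2)⁻¹ * ∑ i, sff N l i y ^ 2 - 2 * ∑ i, sffSq N l i y ^ 2) := by
    intro l
    refine sq_sum_mul_le_of_annihilates (A := fun i j => sff N i j y)
      (B := fun i j => tderiv N l (sff N i j) y) (u := fun i => y i) (v := fun i => N y i)
      (a := fun i => sff N l i y) (b := fun i => sffSq N l i y)
      (pow_ne_zero 2 (norm_ne_zero_iff.2 hy0)) hs (hN.sum_mul_self hy) hyN (hN.sff_comm hy)
      (h.sum_sff_mul_self hk hE hy hyE) (hN.sum_sff_mul_normal hy)
      (fun i j => hN.tderiv_sff_comm hy i j l)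
      (fun i => h.sum_tderiv_sff_mul_self hk hE hy hyE i l)
      (fun i => hN.sum_tderiv_sff_mul_normal hy i l) ?_ ?_ ?_
    · rw [hcomm, h.sum_sff_mul_self hk hE hy hyE]
    · rw [hcomm, hN.sum_sff_mul_normal hy]
    · rw [← hN.sum_sffSq_mul_normal hy l]
      exact Finset.sum_congr rfl fun i _ => by rw [hN.sffSq_comm hy]
  refine (Finset.sum_le_sum fun l _ => key l).trans (le_of_eq ?_)
  have e : ∑ l, ∑ i, sff N l i y ^ 2 = sffNormSq N y :=
    Finset.sum_congr rfl fun i _ => Finset.sum_congr rfl fun j _ => sq _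
  rw [← Finset.mul_sum]
  simp only [Finset.sum_sub_distrib, ← Finset.mul_sum]
  rw [e]
  ring

/-- Simons' identity for the boundary of a set with vanishing mean curvature. -/
theorem laplaceBeltrami_secondFormNorm_sq (h : IsDefiningFunction k E U φ) (hk : 4 ≤ k)
    (hH : ∀ z ∈ U, z ∈ frontier E → meanCurvature E z = 0) (hy : y ∈ U) (hyE : y ∈ frontier E) :
    laplaceBeltrami E (fun z => secondFormNorm E z ^ 2) y
      = 2 * (∑ l, ∑ i, ∑ j, tderiv (unitGradient φ) l (sff (unitGradient φ) i j) y ^ 2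
        - sffNormSq (unitGradient φ) y ^ 2
        - 2 * ∑ i, ∑ j, sffSq (unitGradient φ) i j y ^ 2) := by
  have hk1 : 1 ≤ k := le_trans (by norm_num) hk
  have hN := h.isNormalField hk
  have h0 : ∀ z ∈ U, z ∈ frontier E → sffTrace (unitGradient φ) z = 0 := fun z hz hzE =>
    (h.meanCurvature_eq hk hz hzE).symm.trans (hH z hz hzE)
  rw [h.laplaceBeltrami_eq hk hy hyE (fun z hz hzE => h.secondFormNorm_sq hk hz hzE)
    hN.contDiffOn_sffNormSq]
  -- The trace vanishes only on the boundary, but so do its tangential derivatives, hence also their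
  -- tangential derivatives.
  refine hN.sum_tderiv_tderiv_sffNormSq hy (h0 y hy hyE) fun i j => ?_
  refine h.tderiv_eq_zero hk1 hy hyE (fun z hz hzE => ?_)
    (hN.differentiableAt_tderiv hy hN.contDiffOn_sffTrace j) i
  exact h.tderiv_eq_zero hk1 hz hzE h0
    ((hN.contDiffOn_sffTrace.differentiableOn (by norm_num)).differentiableAt
      (h.isOpen.mem_nhds hz)) j

theorem laplaceBeltrami_nonneg_of_secondFormNorm_eq_zero (h : IsDefiningFunction k E U φ)
    (hk : 4 ≤ k) (hH : ∀ z ∈ U, z ∈ frontier E → meanCurvature E z = 0) (hy : y ∈ U)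
    (hyE : y ∈ frontier E) (hc : secondFormNorm E y = 0) :
    0 ≤ laplaceBeltrami E (fun z => secondFormNorm E z ^ 2) y := by
  have hg : sffNormSq (unitGradient φ) y = 0 := by
    rw [← h.secondFormNorm_sq hk hy hyE, hc, zero_pow two_ne_zero]
  have hA : ∀ i j, sff (unitGradient φ) i j y = 0 := by
    intro i j
    have h1 := (Finset.sum_eq_zero_iff_of_nonneg fun i _ =>
      Finset.sum_nonneg fun j _ => mul_self_nonneg _).1 hg i (Finset.mem_univ i)
    exact mul_self_eq_zero.1 ((Finset.sum_eq_zero_iff_of_nonneg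
      fun j _ => mul_self_nonneg _).1 h1 j (Finset.mem_univ j))
  rw [h.laplaceBeltrami_secondFormNorm_sq hk hH hy hyE, hg]
  simp only [sffSq, hA]
  simp only [mul_zero, Finset.sum_const_zero, ne_eq, OfNat.ofNat_ne_zero, not_false_eq_true,
    zero_pow, sub_zero]
  positivity

/-- The product rule for c · c, compared with the derivative of |A|²; no square root has to be
differentiated. -/
theorem secondFormNorm_mul_tangentialDeriv (h : IsDefiningFunction k E U φ) (hk : 4 ≤ k)
    (hy : y ∈ U) (hyE : y ∈ frontier E)
    (hd : DifferentiableWithinAt ℝ (secondFormNorm E) (frontier E) y) (l : Fin n) :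
    secondFormNorm E y * tangentialDeriv E (secondFormNorm E) y (EuclideanSpace.single l 1)
      = ∑ i, ∑ j, sff (unitGradient φ) i j y
        * tderiv (unitGradient φ) l (sff (unitGradient φ) i j) y := by
  have hk1 : 1 ≤ k := le_trans (by norm_num) hk
  have hN := h.isNormalField hk
  have h1 := h.tangentialDeriv_single_eq_tderiv hk1 hy hyE
    (f := fun z => secondFormNorm E z * secondFormNorm E z)
    (fun z hz hzE => by rw [← sq]; exact h.secondFormNorm_sq hk hz hzE)
    (hN.differentiableAt_sffNormSq hy) l
  have h2 := hd.hasFDerivWithinAt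
  rw [h.tangentialDeriv_eq hk1 hy hyE (h2.fun_mul h2), hN.tderiv_sffNormSq hy] at h1
  rw [h.tangentialDeriv_eq hk1 hy hyE h2]
  simp only [add_apply, smul_apply, smul_eq_mul, mul_assoc, ← Finset.mul_sum] at h1
  linarith

/-- A tangential vector and its negative both lie in the positive tangent cone, so the first-order
condition holds in both directions. -/
theorem tangentialDeriv_eq_zero_of_isMinOn (h : IsDefiningFunction k E U φ) (hk : 1 ≤ k)
    (hy : y ∈ U) (hyE : y ∈ frontier E) {f : EuclideanSpace ℝ (Fin n) → ℝ}
    (hf : IsMinOn f (frontier E) y) (v : EuclideanSpace ℝ (Fin n)) :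
    tangentialDeriv E f y v = 0 := by
  rw [tangentialDeriv, h.exteriorNormal_eq hk hy hyE]
  have hw := h.inner_tangential hy v
  exact hf.localize.fderivWithin_eq_zero (h.mem_posTangentConeAt hk hy hyE hw)
    (h.mem_posTangentConeAt hk hy hyE (by rw [inner_neg_right, hw, neg_zero]))

/-- Simons' inequality at a point of a regular piece of the boundary of a cone. -/
theorem simons_inequality (h : IsDefiningFunction k E U φ) (hk : 4 ≤ k) (hE : IsCone E)
    (hH : ∀ z ∈ U, z ∈ frontier E → meanCurvature E z = 0) (hy : y ∈ U) (hyE : y ∈ frontier E)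
    (hy0 : y ≠ 0) (hd : DifferentiableWithinAt ℝ (secondFormNorm E) (frontier E) y) :
    ‖tangentialGradient E (secondFormNorm E) y‖ ^ 2
        + 2 * secondFormNorm E y ^ 2 / ‖y‖ ^ 2 - secondFormNorm E y ^ 4
      ≤ laplaceBeltrami E (fun z => secondFormNorm E z ^ 2) y / 2 := by
  have hk1 : 1 ≤ k := le_trans (by norm_num) hk
  have hgrad : ‖tangentialGradient E (secondFormNorm E) y‖ ^ 2
      = ∑ l, tangentialDeriv E (secondFormNorm E) y (EuclideanSpace.single l 1) ^ 2 :=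
    EuclideanSpace.real_norm_sq_eq _
  rw [hgrad]
  rcases eq_or_ne (secondFormNorm E y) 0 with hc | hc
  · have hmin : IsMinOn (secondFormNorm E) (frontier E) y := fun z _ => by
      rw [mem_ofPred_eq, hc]
      exact Real.sqrt_nonneg _
    have h1 := h.laplaceBeltrami_nonneg_of_secondFormNorm_eq_zero hk hH hy hyE hc
    simp only [h.tangentialDeriv_eq_zero_of_isMinOn hk1 hy hyE hmin, hc]
    norm_num
    linarith
  · have hc2 : 0 < secondFormNorm E y ^ 2 := by positivity
    have h1 := h.sum_sq_sum_sff_mul_tderiv_le hk hE hy hyE hy0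
    simp only [← h.secondFormNorm_mul_tangentialDeriv hk hy hyE hd, mul_pow,
      ← Finset.mul_sum, ← h.secondFormNorm_sq hk hy hyE] at h1
    -- Cancelling c² leaves |∇c|² ≤ |δA|² − 2c²/|y|² − 2|A²|², and Simons' identity evaluates |δA|²
    -- − 2|A²|² as ½ Δc² + c⁴.
    have h2 := le_of_mul_le_mul_left h1 hc2
    rw [h.laplaceBeltrami_secondFormNorm_sq hk hH hy hyE, ← h.secondFormNorm_sq hk hy hyE]
    nlinarith

end IsDefiningFunction

end ConeGeometry

/-- Simons' inequality for cones with zero mean curvature at regular points. Where `c` vanishes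
it need not be differentiable, and the last clause is what remains there. -/
theorem mainTheorem2 (n : ℕ) (k : WithTop ℕ∞) (hk : 4 ≤ k)
    (E : Set (EuclideanSpace ℝ (Fin n))) (hE : IsCone E)
    (hH : ∀ y, IsRegularPoint k E y → meanCurvature E y = 0)
    (x : EuclideanSpace ℝ (Fin n)) (hx : IsRegularPoint k E x) (hx0 : x ≠ 0) :
    (∃ g : EuclideanSpace ℝ (Fin n) → ℝ, ContDiffAt ℝ 2 g x ∧
      (fun y => secondFormNorm E y ^ 2) =ᶠ[𝓝[frontier E] x] g) ∧
    (secondFormNorm E x ≠ 0 → DifferentiableWithinAt ℝ (secondFormNorm E) (frontier E) x) ∧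
    (DifferentiableWithinAt ℝ (secondFormNorm E) (frontier E) x →
      laplaceBeltrami E (fun y => secondFormNorm E y ^ 2) x / 2 ≥
        ‖tangentialGradient E (secondFormNorm E) x‖ ^ 2
          + 2 * secondFormNorm E x ^ 2 / ‖x‖ ^ 2 - secondFormNorm E x ^ 4) ∧
    (secondFormNorm E x = 0 → 0 ≤ laplaceBeltrami E (fun y => secondFormNorm E y ^ 2) x) := by
  obtain ⟨hxE, U, φ, hxU, h⟩ := hx
  have hN := h.isNormalField hk
  have hH' : ∀ z ∈ U, z ∈ frontier E → meanCurvature E z = 0 := fun z hz hzE =>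
    hH z ⟨hzE, U, φ, hz, h⟩
  have hev : ∀ᶠ z in 𝓝[frontier E] x, z ∈ U ∧ z ∈ frontier E :=
    ((hN.eventually_mem hxU).filter_mono nhdsWithin_le_nhds).and self_mem_nhdsWithin
  refine ⟨⟨sffNormSq (unitGradient φ),
    hN.contDiffOn_sffNormSq.contDiffAt (h.isOpen.mem_nhds hxU), ?_⟩, fun hc => ?_,
    h.simons_inequality hk hE hH' hxU hxE hx0,
    h.laplaceBeltrami_nonneg_of_secondFormNorm_eq_zero hk hH' hxU hxE⟩
  · filter_upwards [hev] with z hz using h.secondFormNorm_sq hk hz.1 hz.2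
  · have hne : sffNormSq (unitGradient φ) x ≠ 0 := by
      rw [← h.secondFormNorm_sq hk hxU hxE]
      exact pow_ne_zero 2 hc
    refine ((hN.differentiableAt_sffNormSq hxU).sqrt hne).differentiableWithinAt.congr_of_eventuallyEq
      ?_ (h.secondFormNorm_eq hk hxU hxE)
    filter_upwards [hev] with z hz using h.secondFormNorm_eq hk hz.1 hz.2
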